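/- **Setting.** Let $\mathcal V$ be a set of variables and let $\Sigma$ be the set of states $\sigma:\mathcal V\to\mathbb Z$. A constraint is a finite formal conjunction of atoms $p_1<p_2$ with $p_1,p_2\in\mathbb Z[\mathcal V]$; $\varphi\models\psi$ means that every state satisfying $\varphi$ satisfies $\psi$. A *probabilistic integer program* (PIP) $\mathcal P=(\mathcal{PV},\mathcal L,\ell_0,\mathcal{GT})$ has a finite set $\mathcal{PV}\subseteq\mathcal V$ of program variables (the others are called temporary), a finite set $\mathcal L$ of locations, an initial location $\ell_0\in\mathcal L$ and a finite set $\mathcal{GT}$ of pairwise disjoint general transitions. A general transition is a finite set of transitions $(\ell,\varphi,p,\eta,\ell')$ with common start location $\ell\in\mathcal L$ and common guard $\varphi$, where the probabilities $p\in[0,1]$ add up to $1$, the updates are maps $\eta:\mathcal{PV}\to\mathbb Z[\mathcal V]$, and the targets satisfy $\ell'\in\mathcal L\setminus\{\ell_0\}$. Let $\mathcal T=\bigcup_{g\in\mathcal{GT}}g$. A (Markovian, deterministic) *scheduler* $\mathfrak S$ maps every configuration $(\ell,\sigma)$, where $\ell\in\mathcal L\cup\{\ell_\bot\}$ and $\sigma\in\Sigma$,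 to a general transition $g\in\mathcal{GT}$ with start location $\ell$ and a state $\tilde\sigma$ that agrees with $\sigma$ on $\mathcal{PV}$ and satisfies the guard of $g$; if no such pair $(g,\tilde\sigma)$ exists (in particular if $\ell=\ell_\bot$), the scheduler terminates the evaluation by choosing $g_\bot=\{t_\bot\}$ and $\tilde\sigma=\sigma$. If $(g,\tilde\sigma)$ is chosen, then each $(\ell,\varphi,p,\eta,\ell')\in g$ is taken with probability $p$ and leads to $(\ell',\sigma')$, where $\sigma'(v)=\tilde\sigma(\eta(v))$ for $v\in\mathcal{PV}$ and $\sigma'(v)=\tilde\sigma(v)$ otherwise; $t_\bot$ leads from $(\ell,\sigma)$ to $(\ell_\bot,\sigma)$ with probability $1$. Together with the initial configuration $(\ell_0,\sigma_0)$ this determines a probability measure on infinite runs, and $\mathcal R^{\mathcal P}_{\mathfrak S,\sigma_0}\in[0,\infty]$ denotes the expected value of the number of transitions from $\mathcal T$ that are executed in a run (counted with repetition). **Control-flow refinement.** Let $S\subseteq\mathcal T$, and for each location $\ell$ let $\alpha_\ell$ be a finite set of constraints of the form $p_1\sim p_2$ with $p_1,p_2\in\mathbb Z[\mathcal{PV}]$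 and ${\sim}\in\{<,\le,=\}$. Labels $\tau$ are finite sets of such constraints, read as conjunctions ($\mathrm{true}=\emptyset$). For a label $\tau$ and a transition $(\ell,\varphi,p,\eta,\ell')$ put $$\tau_{\varphi,\eta,\ell'}=\{\psi\in\alpha_{\ell'}\mid(\tau\wedge\varphi)\models\eta(\psi)\},$$ where $\eta(\psi)$ results from $\psi$ by replacing each $v\in\mathcal{PV}$ by $\eta(v)$. Consider the following conditions on a set $\mathcal L'$ of labelled locations $\langle\ell,\tau\rangle$ and a set $\mathcal{GT}'$ of sets of transitions between labelled locations: 1. $\langle\ell,\mathrm{true}\rangle\in\mathcal L'$ for all $\ell\in\mathcal L$; 2. if $\langle\ell,\tau\rangle\in\mathcal L'$ and $(\ell,\varphi,p,\eta,\ell')\in S$, then $\langle\ell',\tau_{\varphi,\eta,\ell'}\rangle\in\mathcal L'$; 3. if $\langle\ell,\tau\rangle\in\mathcal L'$ and $g\in\mathcal{GT}$ has start location $\ell$, then $\mathcal{GT}'$ contains the set $$\{(\langle\ell,\tau\rangle,\tau\wedge\varphi,p,\eta,\langle\ell',\tau_{\varphi,\eta,\ell'}\rangle)\mid(\ell,\varphi,p,\eta,\ell')\in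 g\cap S\}\cup\{(\langle\ell,\tau\rangle,\tau\wedge\varphi,p,\eta,\langle\ell',\mathrm{true}\rangle)\mid(\ell,\varphi,p,\eta,\ell')\in g\setminus S\}.$$ **Theorem (Soundness of control-flow refinement for PIPs).** There is a PIP $\mathcal P'=(\mathcal{PV},\mathcal L',\langle\ell_0,\mathrm{true}\rangle,\mathcal{GT}')$ such that $\mathcal L'$ and $\mathcal{GT}'$ are the smallest sets satisfying (1), (2) and (3). For this $\mathcal P'$ and all $\sigma_0\in\Sigma$, $$\sup_{\mathfrak S}\mathcal R^{\mathcal P}_{\mathfrak S,\sigma_0}=\sup_{\mathfrak S}\mathcal R^{\mathcal P'}_{\mathfrak S,\sigma_0},$$ where the suprema range over all Markovian schedulers of $\mathcal P$ and of $\mathcal P'$, respectively. -/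

import Mathlib

open MeasureTheory ProbabilityTheory
open scoped NNReal ENNReal Classical

noncomputable section

namespace CFR

universe u v

/-! ### Constraints -/

/-- An atom `lhs < rhs` between integer polynomials over the variables `V`. -/
structure Atom (V : Type u) where
  lhs : MvPolynomial V ℤ
  rhs : MvPolynomial V ℤ

/-- A constraint: a (possibly empty) formal conjunction of atoms. -/
abbrev Constraint (V : Type u) := List (Atom V)

/-- States assign integers to all variables. -/
abbrev State (V : Type u) := V → ℤ

/-- `σ ⊨ p₁ < p₂`. -/
def Atom.Sat {V : Type u} (σ : State V) (a : Atom V) : Prop :=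
  MvPolynomial.eval σ a.lhs < MvPolynomial.eval σ a.rhs

/-- `σ ⊨ φ`. -/
def Sat {V : Type u} (σ : State V) (φ : Constraint V) : Prop :=
  ∀ a ∈ φ, a.Sat σ

/-- `φ ⊨ ψ`: every state that satisfies `φ` satisfies `ψ`. -/
def Entails {V : Type u} (φ ψ : Constraint V) : Prop :=
  ∀ σ : State V, Sat σ φ → Sat σ ψ

/-- The relation symbols allowed in an abstraction layer. -/
inductive Rel
  | lt
  | le
  | eq

/-- The constraint `p ~ q`; over the integers `≤` and `=` are expressed through `<`. -/
def Rel.toConstraint {V : Type u} (p q : MvPolynomial V ℤ) : Rel → Constraint V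
  | .lt => [⟨p, q⟩]
  | .le => [⟨p, q + 1⟩]
  | .eq => [⟨p, q + 1⟩, ⟨q, p + 1⟩]

/-- Updates `η : PV → ℤ[V]` of the program variables. -/
abbrev Update {V : Type u} (PV : Finset V) := PV → MvPolynomial V ℤ

/-- An element `p₁ ~ p₂` of an abstraction layer, with `p₁, p₂ ∈ ℤ[PV]`. -/
structure LayerAtom {V : Type u} (PV : Finset V) where
  lhs : MvPolynomial PV ℤ
  rel : Rel
  rhs : MvPolynomial PV ℤ

/-- `η(ψ)`: the constraint obtained from `ψ` by replacing every program variable `v` by `η v`. -/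
def LayerAtom.subst {V : Type u} {PV : Finset V} (η : Update PV) (ψ : LayerAtom PV) :
    Constraint V :=
  ψ.rel.toConstraint (MvPolynomial.bind₁ η ψ.lhs) (MvPolynomial.bind₁ η ψ.rhs)

/-- `ψ` itself, as a constraint over all variables. -/
def LayerAtom.toConstraint {V : Type u} {PV : Finset V} (ψ : LayerAtom PV) : Constraint V :=
  ψ.subst fun v => MvPolynomial.X (v : V)

/-- A label: a finite set of layer constraints, read as their conjunction; `∅` is `true`. -/
abbrev Label {V : Type u} (PV : Finset V) := Finset (LayerAtom PV)

/-- The constraint `τ ∧ φ`, as a formal conjunction. -/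
def Label.and {V : Type u} {PV : Finset V} (τ : Label PV) (φ : Constraint V) : Constraint V :=
  τ.toList.flatMap LayerAtom.toConstraint ++ φ

/-! ### Probabilistic integer programs -/

/-- A transition `(ℓ, φ, p, η, ℓ')`. -/
structure Transition {V : Type u} (PV : Finset V) (Loc : Type v) where
  src : Loc
  guard : Constraint V
  prob : ℝ≥0
  update : Update PV
  tgt : Loc

/-- A probabilistic integer program with program variables `PV ⊆ V`; the variables in `V \ PV` are
the temporary ones. Locations are the elements of the finite set `locs`. -/
structure PIP {V : Type u} (PV : Finset V) (Loc : Type v) where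
  locs : Finset Loc
  init : Loc
  /-- The general transitions, which are finite sets of transitions. -/
  gts : Finset (Finset (Transition PV Loc))
  init_mem : init ∈ locs
  src_mem : ∀ g ∈ gts, ∀ t ∈ g, t.src ∈ locs
  tgt_mem : ∀ g ∈ gts, ∀ t ∈ g, t.tgt ∈ locs
  tgt_ne_init : ∀ g ∈ gts, ∀ t ∈ g, t.tgt ≠ init
  src_eq : ∀ g ∈ gts, ∀ t ∈ g, ∀ t' ∈ g, t.src = t'.src
  guard_eq : ∀ g ∈ gts, ∀ t ∈ g, ∀ t' ∈ g, t.guard = t'.guard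
  sum_prob : ∀ g ∈ gts, ∑ t ∈ g, t.prob = 1
  disjoint : ∀ g ∈ gts, ∀ g' ∈ gts, g ≠ g' → Disjoint g g'

/-- A configuration: a location, or `none` for the termination location `ℓ_⊥`, and a state. -/
structure Conf (V : Type u) (Loc : Type v) where
  loc : Option Loc
  state : State V

/-- One step `→_t c` of a path; `trans = none` stands for the special transition `t_⊥`. -/
structure Step {V : Type u} (PV : Finset V) (Loc : Type v) where
  trans : Option (Transition PV Loc)
  conf : Conf V Loc

instance {V : Type u} (PV : Finset V) (Loc : Type v) : MeasurableSpace (Step PV Loc) := ⊤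

/-- A run `c₀ →_{t₁} c₁ →_{t₂} ⋯`, where the entry `n + 1` is `→_{t_{n+1}} c_{n+1}`. The entry `0`
holds `c₀` and a dummy transition (almost surely `none`, and never looked at below). The
`σ`-algebra is the product one. -/
abbrev Run {V : Type u} (PV : Finset V) (Loc : Type v) := ℕ → Step PV Loc

/-- The state reached by the transition `t` when the temporary variables have been chosen as in
`σ`: program variables are updated, temporary ones keep the chosen value. -/
def Transition.apply {V : Type u} {PV : Finset V} {Loc : Type v} (t : Transition PV Loc)
    (σ : State V) : State V :=
  fun v => if h : v ∈ PV then MvPolynomial.eval σ (t.update ⟨v, h⟩) else σ v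

namespace PIP

variable {V : Type u} {PV : Finset V} {Loc : Type v}

/-- The set `𝒯` of all transitions. -/
def transitions (P : PIP PV Loc) : Set (Transition PV Loc) := {t | ∃ g ∈ P.gts, t ∈ g}

/-- The general transition `g` of `P` may be taken in `c` with `σ` as choice for the temporary
variables: `σ` agrees with the state of `c` on the program variables, `g` starts in the location
of `c`, and `σ` satisfies the guard of `g`. -/
def Enabled (P : PIP PV Loc) (c : Conf V Loc) (g : Finset (Transition PV Loc))
    (σ : State V) : Prop :=
  g ∈ P.gts ∧ (∀ x ∈ PV, σ x = c.state x) ∧ (∀ t ∈ g, c.loc = some t.src) ∧ ∀ t ∈ g, Sat σ t.guard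

/-- Markovian schedulers; `none` in the first component stands for `g_⊥`. In each configuration
the scheduler picks an enabled general transition together with values for the temporary
variables; it picks `g_⊥` and leaves the state unchanged exactly if there is nothing enabled,
which is in particular the case in the location `ℓ_⊥`. -/
structure Scheduler (P : PIP PV Loc) where
  choice : Conf V Loc → Option (Finset (Transition PV Loc)) × State V
  enabled : ∀ c g, (choice c).1 = some g → P.Enabled c g (choice c).2
  stuck : ∀ c, (choice c).1 = none → (choice c).2 = c.state ∧ ∀ g σ, ¬ P.Enabled c g σ

namespace Scheduler

variable {P : PIP PV Loc} (𝔖 : P.Scheduler)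

/-- `pr(c →_t c')`. -/
def stepProb (c : Conf V Loc) (s : Step PV Loc) : ℝ≥0 :=
  match (𝔖.choice c).1, s.trans with
  | some g, some t =>
      if t ∈ g ∧ s.conf.loc = some t.tgt ∧ s.conf.state = t.apply (𝔖.choice c).2 then t.prob else 0
  | none, none => if s.conf.loc = none ∧ s.conf.state = c.state then 1 else 0
  | _, _ => 0

/-- The distribution of the next step from the configuration `c`. -/
def stepMeasure (c : Conf V Loc) : Measure (Step PV Loc) :=
  match (𝔖.choice c).1 with
  | some g => ∑ t ∈ g, (t.prob : ℝ≥0∞) •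
      Measure.dirac (⟨some t, ⟨some t.tgt, t.apply (𝔖.choice c).2⟩⟩ : Step PV Loc)
  | none => Measure.dirac ⟨none, ⟨none, c.state⟩⟩

instance (c : Conf V Loc) : IsProbabilityMeasure (𝔖.stepMeasure c) := by
  unfold stepMeasure
  split
  · rename_i g hg
    constructor
    have h := P.sum_prob g (𝔖.enabled c g hg).1
    simp only [Measure.coe_finsetSum, Finset.sum_apply, Measure.smul_apply, measure_univ,
      smul_eq_mul, mul_one]
    exact_mod_cast congrArg (fun x : ℝ≥0 => (x : ℝ≥0∞)) h
  · infer_instance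

/-- The transition kernel from the steps `0, …, n` to the step `n + 1`; it only depends on the
last configuration. -/
def kernel (n : ℕ) : Kernel (Π _ : Finset.Iic n, Step PV Loc) (Step PV Loc) where
  toFun h := 𝔖.stepMeasure (h ⟨n, Finset.mem_Iic.2 le_rfl⟩).conf
  measurable' :=
    (measurable_from_top (f := fun s : Step PV Loc => 𝔖.stepMeasure s.conf)).comp
      (measurable_pi_apply _)

instance (n : ℕ) : IsMarkovKernel (𝔖.kernel n) :=
  ⟨fun _ => inferInstanceAs (IsProbabilityMeasure (𝔖.stepMeasure _))⟩

/-- The probability measure on runs that start in the initial location with state `σ₀`. -/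
def runMeasure (σ₀ : State V) : Measure (Run PV Loc) :=
  Kernel.traj (X := fun _ => Step PV Loc) 𝔖.kernel 0 fun _ => ⟨none, ⟨some P.init, σ₀⟩⟩

/-- The measure of a single step is its probability. -/
theorem stepMeasure_singleton (c : Conf V Loc) (s : Step PV Loc) :
    𝔖.stepMeasure c {s} = 𝔖.stepProb c s := by
  obtain ⟨t, ⟨l, σ⟩⟩ := s
  unfold stepMeasure stepProb
  rcases hg : (𝔖.choice c).1 with _ | g
  · have : (Measure.dirac (⟨none, ⟨none, c.state⟩⟩ : Step PV Loc)) {⟨t, ⟨l, σ⟩⟩} =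
      if t = none ∧ l = none ∧ σ = c.state then 1 else 0 := by
      rw [Measure.dirac_apply]
      simp [Set.indicator, eq_comm]
    rcases t with _ | t <;> simp [this]
    split <;> simp
  · simp only [Measure.coe_finsetSum, Finset.sum_apply, Measure.smul_apply, smul_eq_mul,
      Measure.dirac_apply, Set.indicator, Set.mem_singleton_iff, Step.mk.injEq, Conf.mk.injEq,
      Pi.one_apply]
    rcases t with _ | t
    · simp
    · by_cases ht : t ∈ g
      · rw [Finset.sum_eq_single t]
        · simp only [ht, true_and, eq_comm]
          split <;> simp
        · intro b _ hb; simp [hb]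
        · exact fun h => absurd ht h
      · rw [Finset.sum_eq_zero]
        · simp [ht]
        · intro b hb
          have : b ≠ t := fun h => ht (h ▸ hb)
          simp [this]

instance : MeasurableSingletonClass (Step PV Loc) := ⟨fun _ => trivial⟩

/-- The measure of the set of runs with a given finite prefix is the probability of the prefix. -/
theorem runMeasure_prefix (σ₀ : State V) (f : Run PV Loc) (n : ℕ) :
    𝔖.runMeasure σ₀ {ϑ | ∀ i ≤ n, ϑ i = f i} =
      (if f 0 = ⟨none, ⟨some P.init, σ₀⟩⟩ then 1 else 0) *
        ∏ i ∈ Finset.range n, (𝔖.stepProb (f i).conf (f (i + 1)) : ℝ≥0∞) := by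
  set x₀ : Π _ : Finset.Iic 0, Step PV Loc := fun _ => ⟨none, ⟨some P.init, σ₀⟩⟩ with hx
  have hset : ∀ n, {ϑ : Run PV Loc | ∀ i ≤ n, ϑ i = f i} =
      Preorder.frestrictLe (π := fun _ => Step PV Loc) n ⁻¹'
        {Preorder.frestrictLe (π := fun _ => Step PV Loc) n f} := by
    intro n
    ext ϑ
    simp [funext_iff, Preorder.frestrictLe]
  have key : ∀ n, 𝔖.runMeasure σ₀ {ϑ | ∀ i ≤ n, ϑ i = f i} =
      Kernel.partialTraj (X := fun _ => Step PV Loc) 𝔖.kernel 0 n x₀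
        {Preorder.frestrictLe (π := fun _ => Step PV Loc) n f} := by
    intro n
    rw [← Kernel.traj_map_frestrictLe_apply, Measure.map_apply (by fun_prop) (by measurability),
      hset]
    rfl
  induction n with
  | zero =>
    rw [key, Kernel.partialTraj_self, Kernel.id_apply, Measure.dirac_apply]
    simp only [Set.indicator, Set.mem_singleton_iff, Finset.range_zero, Finset.prod_empty, mul_one,
      Pi.one_apply]
    have : x₀ = Preorder.frestrictLe (π := fun _ => Step PV Loc) 0 f ↔
        f 0 = ⟨none, ⟨some P.init, σ₀⟩⟩ := by
      simp [hx, funext_iff, Preorder.frestrictLe, eq_comm]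
    exact if_congr this rfl rfl
  | succ n ih =>
    rw [Finset.prod_range_succ, ← mul_assoc, ← ih, key n]
    have h := congrArg (fun m => m
        ({Preorder.frestrictLe (π := fun _ => Step PV Loc) n f} ×ˢ {f (n + 1)}))
      (Kernel.partialTraj_compProd_eq_map_traj (X := fun _ => Step PV Loc) (κ := 𝔖.kernel)
        (Nat.zero_le n) (x₀ := x₀))
    beta_reduce at h
    rw [Measure.compProd_apply_prod (by measurability) (by measurability),
      Measure.map_apply (by fun_prop) (by measurability)] at h
    simp only [lintegral_singleton] at h
    rw [mul_comm] at h
    have h2 : 𝔖.kernel n (Preorder.frestrictLe (π := fun _ => Step PV Loc) n f) {f (n + 1)} =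
      𝔖.stepProb (f n).conf (f (n + 1)) := 𝔖.stepMeasure_singleton _ _
    rw [h2] at h
    rw [h]
    congr 1
    ext ϑ
    simp only [Set.mem_ofPred_eq, Set.mem_preimage, Set.mem_prod, Set.mem_singleton_iff,
      Preorder.frestrictLe, funext_iff, Subtype.forall, Finset.mem_Iic]
    constructor
    · exact fun h => ⟨fun i hi => h i (by omega), h _ le_rfl⟩
    · rintro ⟨h1, h2⟩ i hi
      rcases Nat.lt_or_eq_of_le hi with hi | rfl
      · exact h1 i (by omega)
      · exact h2
end Scheduler

/-- How often a transition of `g` is taken in a run. -/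
def runtimeOf (g : Finset (Transition PV Loc)) (ϑ : Run PV Loc) : ℕ∞ :=
  {i : ℕ | ∃ t ∈ g, (ϑ (i + 1)).trans = some t}.encard

/-- The number of transitions of `P` that are executed in a run before termination. -/
def runtime (P : PIP PV Loc) (ϑ : Run PV Loc) : ℕ∞ := ∑ g ∈ P.gts, runtimeOf g ϑ

/-- The expected runtime of `P` under a scheduler, from the initial state `σ₀`. -/
def Scheduler.expectedRuntime {P : PIP PV Loc} (𝔖 : P.Scheduler) (σ₀ : State V) : ℝ≥0∞ :=
  ∫⁻ ϑ, (P.runtime ϑ : ℝ≥0∞) ∂𝔖.runMeasure σ₀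

/-! ### Control-flow refinement -/

/-- `τ_{φ,η,ℓ'} = {ψ ∈ α_{ℓ'} | (τ ∧ φ) ⊨ η(ψ)}`. -/
def nextLabel (α : Loc → Finset (LayerAtom PV)) (τ : Label PV) (t : Transition PV Loc) :
    Label PV :=
  (α t.tgt).filter fun ψ => Entails (τ.and t.guard) (ψ.subst t.update)

/-- The copy of the transition `t` at the location `⟨t.src, τ⟩`. -/
def refineTransition (α : Loc → Finset (LayerAtom PV)) (S : Set (Transition PV Loc))
    (τ : Label PV) (t : Transition PV Loc) : Transition PV (Loc × Label PV) where
  src := (t.src, τ)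
  guard := τ.and t.guard
  prob := t.prob
  update := t.update
  tgt := (t.tgt, if t ∈ S then nextLabel α τ t else ∅)

/-- The closure conditions on the labelled locations `L'` and the general transitions `G'`. -/
structure RefinementClosed (P : PIP PV Loc) (α : Loc → Finset (LayerAtom PV))
    (S : Set (Transition PV Loc)) (L' : Set (Loc × Label PV))
    (G' : Set (Finset (Transition PV (Loc × Label PV)))) : Prop where
  /-- All original locations, labelled with `true`, are present. -/
  initial : ∀ ℓ ∈ P.locs, (ℓ, ∅) ∈ L'
  /-- Transitions in `S` lead to the abstracted label. -/
  abstract : ∀ ℓ τ, (ℓ, τ) ∈ L' → ∀ t ∈ S, t.src = ℓ → (t.tgt, nextLabel α τ t) ∈ L'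
  /-- Every general transition is copied to every labelled variant of its start location. -/
  transition : ∀ ℓ τ, (ℓ, τ) ∈ L' → ∀ g ∈ P.gts, (∀ t ∈ g, t.src = ℓ) →
    g.image (refineTransition α S τ) ∈ G'

/-- `P'` is the result of control-flow refinement of `P` with the abstraction layers `α` and the
set `S` of transitions: its initial location is `⟨ℓ₀, true⟩` and its sets of locations and of
general transitions are the smallest ones that satisfy the closure conditions. -/
structure IsRefinement (P : PIP PV Loc) (α : Loc → Finset (LayerAtom PV))
    (S : Set (Transition PV Loc)) (P' : PIP PV (Loc × Label PV)) : Prop where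
  init_eq : P'.init = (P.init, ∅)
  least : IsLeast {X : Set (Loc × Label PV) × Set (Finset (Transition PV (Loc × Label PV))) |
    RefinementClosed P α S X.1 X.2} ((P'.locs : Set _), (P'.gts : Set _))

end PIP

end CFR

end

noncomputable section

namespace CFR

universe u v

namespace PIP

variable {V : Type u} {PV : Finset V} {Loc : Type v}

/-! Schedulers are not translated one by one: projecting a Markovian scheduler of `P'` to `P` would
make its choice depend on the label, hence on the history. Instead both suprema are identified with
the supremum over `n` of the `n`-step optimal value at the initial configuration, given by a Bellman
recursion (`optValue 1 n`).

The recursions of `P` and `P'` agree by induction on `n` (`IsRefinement.optValue_eq`). Labels are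
invariants: where `τ` holds, adding it to a guard excludes no choice, since `τ` mentions only
program variables, and the next label holds again after the step.

The analytic part is that stationary schedulers attain this value as a supremum
(`iSup_expectedRuntime_eq`), although optimal `n`-step choices may depend on the remaining time and
need not exist. With a discount `β < 1` all values are at most `M = 1/(1-β)`, and a stationary
choice that is greedy up to `ε` loses at most `ε * M`. Then `ε → 0` and `β → 1`. -/

/-- The expected value of `f` in the next configuration if the general transition `g` is taken
with the choice `σ` for the temporary variables. -/
def expectedNext (g : Finset (Transition PV Loc)) (σ : State V) (f : Conf V Loc → ℝ≥0∞) : ℝ≥0∞ :=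
  ∑ t ∈ g, (t.prob : ℝ≥0∞) * f ⟨some t.tgt, t.apply σ⟩

theorem expectedNext_mono {g : Finset (Transition PV Loc)} {σ : State V} {f f' : Conf V Loc → ℝ≥0∞}
    (h : ∀ c, f c ≤ f' c) : expectedNext g σ f ≤ expectedNext g σ f' :=
  Finset.sum_le_sum fun _ _ => mul_le_mul_right (h _) _

theorem expectedNext_add (g : Finset (Transition PV Loc)) (σ : State V)
    (f f' : Conf V Loc → ℝ≥0∞) :
    expectedNext g σ (fun c => f c + f' c) = expectedNext g σ f + expectedNext g σ f' := by
  simp [expectedNext, mul_add, Finset.sum_add_distrib]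

theorem expectedNext_const_mul (g : Finset (Transition PV Loc)) (σ : State V) (a : ℝ≥0∞)
    (f : Conf V Loc → ℝ≥0∞) :
    expectedNext g σ (fun c => a * f c) = a * expectedNext g σ f := by
  simp only [expectedNext, Finset.mul_sum]
  exact Finset.sum_congr rfl fun _ _ => mul_left_comm _ _ _

theorem coe_sum_prob {P : PIP PV Loc} {g : Finset (Transition PV Loc)} (hg : g ∈ P.gts) :
    ∑ t ∈ g, (t.prob : ℝ≥0∞) = 1 := by
  exact_mod_cast congrArg (fun x : ℝ≥0 => (x : ℝ≥0∞)) (P.sum_prob g hg)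

theorem expectedNext_const {P : PIP PV Loc} {g : Finset (Transition PV Loc)} (hg : g ∈ P.gts)
    (σ : State V) (a : ℝ≥0∞) : expectedNext g σ (fun _ => a) = a := by
  rw [expectedNext, ← Finset.sum_mul, coe_sum_prob hg, one_mul]

theorem nonempty_of_mem_gts {P : PIP PV Loc} {g : Finset (Transition PV Loc)} (hg : g ∈ P.gts) :
    g.Nonempty := by
  rw [Finset.nonempty_iff_ne_empty]
  rintro rfl
  simpa using P.sum_prob _ hg

/-! ### Expected runtime of a scheduler as a limit of finite-horizon values -/

namespace Scheduler

variable {P : PIP PV Loc} (𝔖 : P.Scheduler)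

/-- The expected number of transitions taken in the first `n` steps from a configuration. -/
def value : ℕ → Conf V Loc → ℝ≥0∞
  | 0, _ => 0
  | n + 1, c =>
    match (𝔖.choice c).1 with
    | some g => 1 + expectedNext g (𝔖.choice c).2 (value n)
    | none => 0

theorem value_succ_of_some {n : ℕ} {c : Conf V Loc} {g : Finset (Transition PV Loc)}
    (h : (𝔖.choice c).1 = some g) :
    𝔖.value (n + 1) c = 1 + expectedNext g (𝔖.choice c).2 (𝔖.value n) := by
  simp [value, h]

theorem value_succ_of_none {n : ℕ} {c : Conf V Loc} (h : (𝔖.choice c).1 = none) :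
    𝔖.value (n + 1) c = 0 := by
  simp [value, h]

/-- The expected value of `f` in the step after `s`. -/
def stepOp (f : Step PV Loc → ℝ≥0∞) (s : Step PV Loc) : ℝ≥0∞ := ∫⁻ s', f s' ∂𝔖.stepMeasure s.conf

theorem stepOp_of_some {f : Step PV Loc → ℝ≥0∞} {s : Step PV Loc}
    {g : Finset (Transition PV Loc)} (h : (𝔖.choice s.conf).1 = some g) :
    𝔖.stepOp f s =
      ∑ t ∈ g, (t.prob : ℝ≥0∞) * f ⟨some t, ⟨some t.tgt, t.apply (𝔖.choice s.conf).2⟩⟩ := by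
  simp [stepOp, stepMeasure, h, -Measure.coe_nnreal_smul]

theorem stepOp_of_none {f : Step PV Loc → ℝ≥0∞} {s : Step PV Loc}
    (h : (𝔖.choice s.conf).1 = none) :
    𝔖.stepOp f s = f ⟨none, ⟨none, s.conf.state⟩⟩ := by
  simp [stepOp, stepMeasure, h]

/-- The Markov property: the law of a prefix extended by one step is the composition of the law of
the prefix with the kernel, which sees only the last configuration. -/
theorem lintegral_stepOp (σ₀ : State V) (f : Step PV Loc → ℝ≥0∞) (n : ℕ) :
    ∫⁻ ϑ, f (ϑ (n + 1)) ∂𝔖.runMeasure σ₀ = ∫⁻ ϑ, 𝔖.stepOp f (ϑ n) ∂𝔖.runMeasure σ₀ := by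
  set x₀ : Π _ : Finset.Iic 0, Step PV Loc := fun _ => ⟨none, ⟨some P.init, σ₀⟩⟩
  have hf : Measurable f := measurable_from_top
  have hK : Measurable (𝔖.stepOp f) := measurable_from_top
  have h := congrArg (fun m => ∫⁻ p, f p.2 ∂m)
    (Kernel.partialTraj_compProd_eq_map_traj (X := fun _ => Step PV Loc) (κ := 𝔖.kernel)
      (Nat.zero_le n) (x₀ := x₀))
  beta_reduce at h
  rw [Measure.lintegral_compProd (by fun_prop), lintegral_map (by fun_prop) (by fun_prop),
    ← Kernel.traj_map_frestrictLe_apply,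
    lintegral_map (Measurable.lintegral_kernel hf) (by fun_prop)] at h
  exact h.symm

theorem runMeasure_initial (σ₀ : State V) (f : Step PV Loc → ℝ≥0∞) :
    ∫⁻ ϑ, f (ϑ 0) ∂𝔖.runMeasure σ₀ = f ⟨none, ⟨some P.init, σ₀⟩⟩ := by
  set x₀ : Π _ : Finset.Iic 0, Step PV Loc := fun _ => ⟨none, ⟨some P.init, σ₀⟩⟩
  have hf : Measurable f := measurable_from_top
  have h := congrArg (fun m => ∫⁻ p, f (p ⟨0, by simp⟩) ∂m)
    (Kernel.traj_map_frestrictLe_apply (X := fun _ => Step PV Loc) (κ := 𝔖.kernel) 0 0 x₀)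
  beta_reduce at h
  rw [lintegral_map (by fun_prop) (by fun_prop), Kernel.partialTraj_self, Kernel.id_apply,
    lintegral_dirac' _ (by fun_prop)] at h
  exact h

theorem lintegral_step (σ₀ : State V) (f : Step PV Loc → ℝ≥0∞) (n : ℕ) :
    ∫⁻ ϑ, f (ϑ n) ∂𝔖.runMeasure σ₀ = (𝔖.stepOp^[n] f) ⟨none, ⟨some P.init, σ₀⟩⟩ := by
  induction n generalizing f with
  | zero => exact 𝔖.runMeasure_initial σ₀ f
  | succ n ih => rw [lintegral_stepOp, ih, Function.iterate_succ_apply]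

end Scheduler

/-- The number of general transitions that contain the transition of the step `s`. -/
def stepCount (P : PIP PV Loc) (s : Step PV Loc) : ℝ≥0∞ :=
  ∑ g ∈ P.gts, if ∃ t ∈ g, s.trans = some t then 1 else 0

/-- Disjointness of the general transitions leaves exactly one nonzero summand. -/
theorem stepCount_of_mem {P : PIP PV Loc} {g : Finset (Transition PV Loc)} (hg : g ∈ P.gts)
    {t : Transition PV Loc} (ht : t ∈ g) (c : Conf V Loc) : P.stepCount ⟨some t, c⟩ = 1 := by
  rw [stepCount, Finset.sum_eq_single g]
  · exact if_pos ⟨t, ht, rfl⟩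
  · rintro g' hg' hne
    refine if_neg ?_
    rintro ⟨t', ht', h⟩
    obtain rfl : t = t' := Option.some_injective _ h
    exact Finset.disjoint_left.1 (P.disjoint g' hg' g hg hne) ht' ht
  · exact fun h => absurd hg h

theorem stepCount_of_none (P : PIP PV Loc) (c : Conf V Loc) : P.stepCount ⟨none, c⟩ = 0 := by
  simp [stepCount]

theorem toENNReal_encard_setOf (p : ℕ → Prop) [DecidablePred p] :
    (({i | p i}.encard : ℕ∞) : ℝ≥0∞) = ∑' i, if p i then 1 else 0 := by
  rw [← ENNReal.tsum_set_one, tsum_subtype {i | p i} fun _ => (1 : ℝ≥0∞)]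
  exact tsum_congr fun i => by simp [Set.indicator]

theorem runtime_eq_tsum (P : PIP PV Loc) (ϑ : Run PV Loc) :
    (P.runtime ϑ : ℝ≥0∞) = ∑' i, P.stepCount (ϑ (i + 1)) := by
  have h : (P.runtime ϑ : ℝ≥0∞) = ∑ g ∈ P.gts, (runtimeOf g ϑ : ℝ≥0∞) :=
    map_sum ENat.toENNRealRingHom _ _
  rw [h]
  simp only [stepCount]
  rw [Summable.tsum_finsetSum fun _ _ => ENNReal.summable]
  exact Finset.sum_congr rfl fun g _ => toENNReal_encard_setOf _

namespace Scheduler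

variable {P : PIP PV Loc} (𝔖 : P.Scheduler)

theorem stepOp_add (f f' : Step PV Loc → ℝ≥0∞) :
    𝔖.stepOp (f + f') = 𝔖.stepOp f + 𝔖.stepOp f' := by
  ext s
  exact lintegral_add_left measurable_from_top _

theorem stepOp_zero : 𝔖.stepOp 0 = 0 := by
  ext s
  simp [stepOp]

theorem stepOp_sum (n : ℕ) (f : ℕ → Step PV Loc → ℝ≥0∞) :
    𝔖.stepOp (∑ i ∈ Finset.range n, f i) = ∑ i ∈ Finset.range n, 𝔖.stepOp (f i) :=
  map_sum (⟨⟨𝔖.stepOp, 𝔖.stepOp_zero⟩, 𝔖.stepOp_add⟩ :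
    (Step PV Loc → ℝ≥0∞) →+ (Step PV Loc → ℝ≥0∞)) _ _

/-- Conditioning on the first step: by linearity one `stepOp` factors out of the sum, and what
remains is the count of that step plus the value of the remaining horizon. -/
theorem sum_iterate_stepOp (n : ℕ) (s : Step PV Loc) :
    (∑ i ∈ Finset.range n, 𝔖.stepOp^[i + 1] P.stepCount) s = 𝔖.value n s.conf := by
  induction n generalizing s with
  | zero => simp [value]
  | succ n ih =>
    rw [Finset.sum_range_succ']
    simp only [Function.iterate_succ_apply' _ (_ + 1)]
    rw [← stepOp_sum, zero_add, Function.iterate_one, ← stepOp_add]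
    rcases h : (𝔖.choice s.conf).1 with _ | g
    · rw [stepOp_of_none _ h, value_succ_of_none _ h, Pi.add_apply, ih, stepCount_of_none, add_zero]
      have hs := 𝔖.stuck _ h
      rcases n with _ | n
      · rfl
      -- After termination nothing is enabled, because a general transition is nonempty and starts
      -- in a proper location.
      · rcases h' : (𝔖.choice ⟨none, s.conf.state⟩).1 with _ | g
        · exact 𝔖.value_succ_of_none h'
        · have he := 𝔖.enabled _ _ h'
          obtain ⟨t, ht⟩ := nonempty_of_mem_gts he.1
          exact absurd (he.2.2.1 t ht) (by simp)
    · have hg := (𝔖.enabled _ _ h).1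
      rw [stepOp_of_some _ h, value_succ_of_some _ h, expectedNext, ← coe_sum_prob hg,
        ← Finset.sum_add_distrib]
      refine Finset.sum_congr rfl fun t ht => ?_
      rw [Pi.add_apply, ih, stepCount_of_mem hg ht, mul_add, mul_one, add_comm]

theorem expectedRuntime_eq_iSup (σ₀ : State V) :
    𝔖.expectedRuntime σ₀ = ⨆ n, 𝔖.value n ⟨some P.init, σ₀⟩ := by
  have hm : Measurable P.stepCount := measurable_from_top
  simp only [expectedRuntime, runtime_eq_tsum]
  rw [lintegral_tsum (f := fun i (ϑ : Run PV Loc) => P.stepCount (ϑ (i + 1))) fun i => (hm.comp (measurable_pi_apply (i + 1))).aemeasurable,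
    ENNReal.tsum_eq_iSup_nat]
  refine iSup_congr fun n => ?_
  rw [← 𝔖.sum_iterate_stepOp n ⟨none, ⟨some P.init, σ₀⟩⟩, Finset.sum_apply]
  exact Finset.sum_congr rfl fun i _ => 𝔖.lintegral_step σ₀ _ _

end Scheduler

/-! ### Optimal values and nearly optimal stationary schedulers -/

/-- The maximal expected `β`-discounted number of transitions taken in `n` steps. -/
def optValue (P : PIP PV Loc) (β : ℝ≥0∞) : ℕ → Conf V Loc → ℝ≥0∞
  | 0, _ => 0
  | n + 1, c => ⨆ (g) (σ) (_ : P.Enabled c g σ), 1 + β * expectedNext g σ (optValue P β n)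

theorem le_optValue_succ {P : PIP PV Loc} {c : Conf V Loc} {g : Finset (Transition PV Loc)}
    {σ : State V} (h : P.Enabled c g σ) (β : ℝ≥0∞) (n : ℕ) :
    1 + β * expectedNext g σ (P.optValue β n) ≤ P.optValue β (n + 1) c :=
  le_iSup_of_le g <| le_iSup_of_le σ <|
    le_iSup (fun _ : P.Enabled c g σ => 1 + β * expectedNext g σ (P.optValue β n)) h

theorem Scheduler.value_le_optValue {P : PIP PV Loc} (𝔖 : P.Scheduler) (n : ℕ) (c : Conf V Loc) :
    𝔖.value n c ≤ P.optValue 1 n c := by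
  induction n generalizing c with
  | zero => exact le_rfl
  | succ n ih =>
    rcases h : (𝔖.choice c).1 with _ | g
    · rw [𝔖.value_succ_of_none h]
      exact zero_le
    · rw [𝔖.value_succ_of_some h]
      refine le_trans ?_ (le_optValue_succ (𝔖.enabled c g h) 1 n)
      rw [one_mul]
      gcongr
      exact expectedNext_mono ih

/-- Within `n` steps every counted transition has weight `β ^ k` with `k < n`, which is at least `β
^ n`. -/
theorem pow_mul_optValue_le (P : PIP PV Loc) {β : ℝ≥0∞} (hβ : β ≤ 1) (n : ℕ) (c : Conf V Loc) :
    β ^ n * P.optValue 1 n c ≤ P.optValue β n c := by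
  induction n generalizing c with
  | zero => simp [optValue]
  | succ n ih =>
    rw [optValue]
    simp only [ENNReal.mul_iSup]
    refine iSup_le fun g => iSup_le fun σ => iSup_le fun h => ?_
    refine le_trans ?_ (le_optValue_succ h β n)
    rw [mul_add, mul_one, one_mul, pow_succ', mul_assoc, ← expectedNext_const_mul]
    gcongr
    · rw [← pow_succ']
      exact pow_le_one₀ zero_le hβ
    · exact expectedNext_mono ih

theorem optValue_le (P : PIP PV Loc) {β M : ℝ≥0∞} (hM : 1 + β * M = M) (n : ℕ) (c : Conf V Loc) :
    P.optValue β n c ≤ M := by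
  induction n generalizing c with
  | zero => exact zero_le
  | succ n ih =>
    refine iSup_le fun g => iSup_le fun σ => iSup_le fun h => ?_
    calc 1 + β * expectedNext g σ (P.optValue β n) ≤ 1 + β * expectedNext g σ (fun _ => M) := by
          gcongr
          exact expectedNext_mono ih
      _ = M := by rw [expectedNext_const h.1, hM]

/-- The maximal expected `β`-discounted number of transitions taken. -/
def discountedValue (P : PIP PV Loc) (β : ℝ≥0∞) (c : Conf V Loc) : ℝ≥0∞ := ⨆ n, P.optValue β n c

/-- The half of the Bellman equation needed for greedy choices; monotonicity suffices, with no
exchange of suprema and sums. -/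
theorem discountedValue_le_iSup (P : PIP PV Loc) (β : ℝ≥0∞) (c : Conf V Loc) :
    P.discountedValue β c ≤
      ⨆ (g) (σ) (_ : P.Enabled c g σ), 1 + β * expectedNext g σ (P.discountedValue β) := by
  refine iSup_le fun n => ?_
  rcases n with _ | n
  · exact zero_le
  · refine iSup_mono fun g => iSup_mono fun σ => iSup_mono fun _ => ?_
    gcongr
    exact expectedNext_mono fun c => le_iSup (fun n => P.optValue β n c) n

/-- Some enabled choice is optimal for the discounted problem up to `ε`. -/
theorem exists_enabled_discountedValue_le (P : PIP PV Loc) {β M ε : ℝ≥0∞} (hM : 1 + β * M = M)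
    (hM' : M ≠ ∞) (hε : ε ≠ 0) {c : Conf V Loc} (hc : ∃ g σ, P.Enabled c g σ) :
    ∃ g σ, P.Enabled c g σ ∧
      P.discountedValue β c ≤ ε + (1 + β * expectedNext g σ (P.discountedValue β)) := by
  have hfin : P.discountedValue β c ≠ ∞ :=
    ne_top_of_le_ne_top hM' (iSup_le fun n => P.optValue_le hM n c)
  by_cases h0 : P.discountedValue β c = 0
  · obtain ⟨g, σ, h⟩ := hc
    exact ⟨g, σ, h, h0 ▸ zero_le⟩
  -- For a finite nonzero value `v`, `v - ε < v` is strict, so some choice exceeds `v - ε`.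
  · have h := (ENNReal.sub_lt_self hfin h0 hε).trans_le (P.discountedValue_le_iSup β c)
    simp only [lt_iSup_iff] at h
    obtain ⟨g, σ, h, hlt⟩ := h
    exact ⟨g, σ, h, tsub_le_iff_left.1 hlt.le⟩

/-- The scheduler is `ε`-greedy and fixed before `n`. Its losses add up to at most `ε * (1 + β + ⋯)
= ε * M`, and what is earned after `n` steps is at most `β ^ n * M`. -/
theorem exists_scheduler_discountedValue_le (P : PIP PV Loc) {β M ε : ℝ≥0∞} (hM : 1 + β * M = M)
    (hM' : M ≠ ∞) (hε : ε ≠ 0) :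
    ∃ 𝔖 : P.Scheduler, ∀ n c, P.discountedValue β c ≤ ε * M + 𝔖.value n c + β ^ n * M := by
  choose! G τ hE hle using fun (c : Conf V Loc) (hc : ∃ g σ, P.Enabled c g σ) =>
    P.exists_enabled_discountedValue_le hM hM' hε hc
  let 𝔖 : P.Scheduler :=
    { choice := fun c => if ∃ g σ, P.Enabled c g σ then (some (G c), τ c) else (none, c.state)
      enabled := by
        intro c g h
        by_cases hc : ∃ g σ, P.Enabled c g σ
        · simp only [if_pos hc, Option.some.injEq] at h ⊢
          exact h ▸ hE c hc
        · simp [if_neg hc] at h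
      stuck := by
        intro c h
        by_cases hc : ∃ g σ, P.Enabled c g σ
        · simp [if_pos hc] at h
        · simp only [if_neg hc, true_and]
          exact fun g σ h => hc ⟨g, σ, h⟩ }
  refine ⟨𝔖, fun n => ?_⟩
  induction n with
  | zero =>
    intro c
    rw [pow_zero, one_mul]
    exact le_add_of_nonneg_of_le zero_le (iSup_le fun n => P.optValue_le hM n c)
  | succ n ih =>
    intro c
    by_cases hc : ∃ g σ, P.Enabled c g σ
    · have h : 𝔖.choice c = (some (G c), τ c) := if_pos hc
      have hg := (hE c hc).1
      rw [𝔖.value_succ_of_some (congrArg Prod.fst h), h]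
      have hβ : β ≤ 1 := by
        by_contra! hlt
        refine absurd hM.le (not_le.2 ?_)
        calc M < M + 1 := ENNReal.lt_add_right hM' one_ne_zero
          _ ≤ 1 + β * M := by
            rw [add_comm]
            gcongr
            exact le_mul_of_one_le_left zero_le hlt.le
      calc P.discountedValue β c
          ≤ ε + (1 + β * expectedNext (G c) (τ c) (P.discountedValue β)) := hle c hc
        _ ≤ ε + (1 + β * expectedNext (G c) (τ c)
              (fun c => ε * M + 𝔖.value n c + β ^ n * M)) := by
          gcongr
          exact expectedNext_mono ih
        -- The new loss `ε` and the discounted old loss `β * ε * M` recombine to `ε * M` by the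
        -- fixed-point equation `hM`.
        _ = ε * (1 + β * M) + (1 + β * expectedNext (G c) (τ c) (𝔖.value n)) +
              β ^ (n + 1) * M := by
          rw [expectedNext_add, expectedNext_add, expectedNext_const hg, expectedNext_const hg]
          ring
        _ ≤ ε * M + (1 + expectedNext (G c) (τ c) (𝔖.value n)) + β ^ (n + 1) * M := by
          rw [hM]
          gcongr
          exact mul_le_of_le_one_left zero_le hβ
    -- Nothing is enabled, so the supremum is empty and equals `0`.
    · refine le_trans (P.discountedValue_le_iSup β c) ?_
      simp only [not_exists] at hc
      simp [hc]

/-- Markovian deterministic schedulers attain the value of the runtime maximization problem. -/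
theorem iSup_expectedRuntime_eq (P : PIP PV Loc) (σ₀ : State V) :
    ⨆ 𝔖 : P.Scheduler, 𝔖.expectedRuntime σ₀ = ⨆ n, P.optValue 1 n ⟨some P.init, σ₀⟩ := by
  refine le_antisymm (iSup_le fun 𝔖 => ?_) (iSup_le fun n => ?_)
  · rw [𝔖.expectedRuntime_eq_iSup]
    exact iSup_mono fun n => 𝔖.value_le_optValue n _
  set c₀ : Conf V Loc := ⟨some P.init, σ₀⟩
  set R := ⨆ 𝔖 : P.Scheduler, 𝔖.expectedRuntime σ₀
  have key : ∀ β : ℝ≥0∞, β < 1 → β ^ n * P.optValue 1 n c₀ ≤ R := by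
    intro β hβ
    set M := (1 - β)⁻¹
    have hpos : 1 - β ≠ 0 := (tsub_pos_of_lt hβ).ne'
    have hM' : M ≠ ∞ := ENNReal.inv_ne_top.2 hpos
    have hM : 1 + β * M = M := by
      have h1 : (1 - β) * M = 1 :=
        ENNReal.mul_inv_cancel hpos (ne_top_of_le_ne_top ENNReal.one_ne_top tsub_le_self)
      nth_rw 1 [← h1]
      rw [← add_mul, tsub_add_cancel_of_le hβ.le, one_mul]
    have hle : ∀ ε : ℝ≥0∞, ε ≠ 0 → P.discountedValue β c₀ ≤ ε * M + R := by
      intro ε hε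
      obtain ⟨𝔖, h𝔖⟩ := P.exists_scheduler_discountedValue_le hM hM' hε
      -- For fixed `β` and `ε` the tail `β ^ k * M` vanishes as `k → ∞`.
      have hlim : Filter.Tendsto (fun k : ℕ => ε * M + R + β ^ k * M) Filter.atTop
          (nhds (ε * M + R + 0 * M)) :=
        tendsto_const_nhds.add (ENNReal.Tendsto.mul_const
          (ENNReal.tendsto_pow_atTop_nhds_zero_of_lt_one hβ) (Or.inr hM'))
      rw [zero_mul, add_zero] at hlim
      refine ge_of_tendsto' hlim fun k => (h𝔖 k c₀).trans ?_
      gcongr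
      refine le_trans ?_ (le_iSup _ 𝔖)
      rw [𝔖.expectedRuntime_eq_iSup]
      exact le_iSup (fun n => 𝔖.value n c₀) k
    have hlim : Filter.Tendsto (fun ε : ℝ≥0∞ => ε * M + R) (nhdsWithin 0 {0}ᶜ)
        (nhds (0 * M + R)) :=
      ((ENNReal.Tendsto.mul_const Filter.tendsto_id (Or.inr hM')).add tendsto_const_nhds).mono_left
        nhdsWithin_le_nhds
    rw [zero_mul, zero_add] at hlim
    have hdisc : P.discountedValue β c₀ ≤ R := by
      exact ge_of_tendsto hlim (eventually_mem_nhdsWithin.mono fun ε hε => hle ε hε)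
    exact (P.pow_mul_optValue_le hβ.le n c₀).trans
      ((le_iSup (fun n => P.optValue β n c₀) n).trans hdisc)
  have hlim : Filter.Tendsto (fun β : ℝ≥0∞ => β ^ n * P.optValue 1 n c₀) (nhdsWithin 1 (Set.Iio 1))
      (nhds (1 ^ n * P.optValue 1 n c₀)) :=
    (ENNReal.Tendsto.mul_const ((ENNReal.continuous_pow n).tendsto 1)
      (Or.inl (by simp))).mono_left nhdsWithin_le_nhds
  rw [one_pow, one_mul] at hlim
  have : (nhdsWithin (1 : ℝ≥0∞) (Set.Iio 1)).NeBot := nhdsLT_neBot_of_exists_lt ⟨0, one_pos⟩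
  exact le_of_tendsto hlim (eventually_mem_nhdsWithin.mono fun β hβ => key β hβ)

/-! ### Existence of the refined program -/

/-- The labelled locations that are reachable by the closure conditions of control-flow
refinement. -/
inductive Labelled (P : PIP PV Loc) (α : Loc → Finset (LayerAtom PV))
    (S : Set (Transition PV Loc)) : Loc → Label PV → Prop
  | initial {ℓ : Loc} (h : ℓ ∈ P.locs) : Labelled P α S ℓ ∅
  | abstract {τ : Label PV} {t : Transition PV Loc} (h : Labelled P α S t.src τ) (ht : t ∈ S) :
      Labelled P α S t.tgt (nextLabel α τ t)

section Refinement

variable (P : PIP PV Loc) (α : Loc → Finset (LayerAtom PV)) (S : Set (Transition PV Loc))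

/-- The least set of labelled locations. -/
def refinedLocs : Set (Loc × Label PV) := {x | Labelled P α S x.1 x.2}

/-- The least set of general transitions between labelled locations. -/
def refinedGts : Set (Finset (Transition PV (Loc × Label PV))) :=
  {g' | ∃ ℓ τ, Labelled P α S ℓ τ ∧ ∃ g ∈ P.gts, (∀ t ∈ g, t.src = ℓ) ∧
    g' = g.image (refineTransition α S τ)}

theorem isLeast_refinement : IsLeast {X : Set (Loc × Label PV) ×
    Set (Finset (Transition PV (Loc × Label PV))) | RefinementClosed P α S X.1 X.2}
    (refinedLocs P α S, refinedGts P α S) := by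
  refine ⟨⟨fun ℓ h => .initial h, ?_, fun ℓ τ h g hg hs => ⟨ℓ, τ, h, g, hg, hs, rfl⟩⟩, ?_⟩
  · rintro ℓ τ h t ht rfl
    exact .abstract h ht
  · rintro ⟨L, G⟩ h
    have hL : ∀ ℓ τ, Labelled P α S ℓ τ → (ℓ, τ) ∈ L := by
      intro ℓ τ hl
      induction hl with
      | initial hl => exact h.initial _ hl
      | abstract _ ht ih => exact h.abstract _ _ ih _ ht rfl
    refine ⟨fun x hx => hL _ _ hx, ?_⟩
    rintro _ ⟨ℓ, τ, hl, g, hg, hs, rfl⟩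
    exact h.transition ℓ τ (hL _ _ hl) g hg hs

variable {P α S}

/-- Guards are formal conjunctions, so the common prefix `τ` cancels. Hence copying merges no
transitions and probabilities still sum to `1`. -/
theorem refineTransition_injective (τ : Label PV) :
    Function.Injective (refineTransition (PV := PV) α S τ) := by
  rintro ⟨s, φ, p, η, l⟩ ⟨s', φ', p', η', l'⟩ h
  simp only [refineTransition, Label.and, Transition.mk.injEq, Prod.mk.injEq,
    List.append_cancel_left_eq] at h ⊢
  exact ⟨h.1.1, h.2.1, h.2.2.1, h.2.2.2.1, h.2.2.2.2.1⟩

theorem labelled_tgt {t : Transition PV Loc} {g} (hg : g ∈ P.gts)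
    (ht : t ∈ g) {τ : Label PV} (h : Labelled P α S t.src τ) :
    Labelled P α S t.tgt (if t ∈ S then nextLabel α τ t else ∅) := by
  split_ifs with hts
  · exact .abstract h hts
  · exact .initial (P.tgt_mem g hg t ht)

/-- Confines the labels at `ℓ` to the finite powerset of `α ℓ`, whence finiteness of the refinement.
-/
theorem Labelled.mem_locs_and_subset (hS : S ⊆ P.transitions) {ℓ : Loc} {τ : Label PV}
    (h : Labelled P α S ℓ τ) : ℓ ∈ P.locs ∧ τ ⊆ α ℓ := by
  cases h with
  | initial h => exact ⟨h, Finset.empty_subset _⟩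
  | abstract h ht =>
    obtain ⟨g, hg, htg⟩ := hS ht
    exact ⟨P.tgt_mem g hg _ htg, Finset.filter_subset _ _⟩

theorem finite_refinedLocs (hS : S ⊆ P.transitions) : (refinedLocs P α S).Finite := by
  refine Set.Finite.subset
    (P.locs.biUnion fun ℓ => (α ℓ).powerset.image fun τ => (ℓ, τ)).finite_toSet ?_
  rintro ⟨ℓ, τ⟩ h
  obtain ⟨h1, h2⟩ := Labelled.mem_locs_and_subset hS h
  simpa using ⟨h2, h1⟩

theorem finite_refinedGts (hS : S ⊆ P.transitions) : (refinedGts P α S).Finite := by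
  refine (((finite_refinedLocs (α := α) hS).prod P.gts.finite_toSet).image
    fun x => x.2.image (refineTransition α S x.1.2)).subset ?_
  rintro _ ⟨ℓ, τ, h, g, hg, -, rfl⟩
  exact ⟨((ℓ, τ), g), ⟨h, hg⟩, rfl⟩

theorem exists_isRefinement (hS : S ⊆ P.transitions) :
    ∃ P' : PIP PV (Loc × Label PV), P.IsRefinement α S P' := by
  have hL : ∀ x, x ∈ (finite_refinedLocs (α := α) hS).toFinset ↔ Labelled P α S x.1 x.2 :=
    fun x => Set.Finite.mem_toFinset _
  have hG : ∀ g', g' ∈ (finite_refinedGts (α := α) hS).toFinset → ∃ ℓ τ, Labelled P α S ℓ τ ∧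
      ∃ g ∈ P.gts, (∀ t ∈ g, t.src = ℓ) ∧ g' = g.image (refineTransition α S τ) :=
    fun x => (Set.Finite.mem_toFinset _).1
  refine ⟨{
    locs := (finite_refinedLocs (α := α) hS).toFinset
    init := (P.init, ∅)
    gts := (finite_refinedGts (α := α) hS).toFinset
    init_mem := (hL _).2 (.initial P.init_mem)
    src_mem := ?_
    tgt_mem := ?_
    tgt_ne_init := ?_
    src_eq := ?_
    guard_eq := ?_
    sum_prob := ?_
    disjoint := ?_ }, rfl, ?_⟩
  · intro g' hg'
    obtain ⟨ℓ, τ, h, g, hg, hs, rfl⟩ := hG g' hg'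
    simp only [Finset.forall_mem_image]
    intro t ht
    rw [hL]
    simpa [refineTransition, hs t ht] using h
  · intro g' hg'
    obtain ⟨ℓ, τ, h, g, hg, hs, rfl⟩ := hG g' hg'
    simp only [Finset.forall_mem_image]
    intro t ht
    rw [hL]
    exact labelled_tgt hg ht (hs t ht ▸ h)
  · intro g' hg'
    obtain ⟨ℓ, τ, h, g, hg, hs, rfl⟩ := hG g' hg'
    simp only [Finset.forall_mem_image]
    exact fun t ht he => P.tgt_ne_init g hg t ht (congrArg Prod.fst he)
  · intro g' hg'
    obtain ⟨ℓ, τ, h, g, hg, hs, rfl⟩ := hG g' hg'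
    simp only [Finset.forall_mem_image]
    intro t ht t' ht'
    simp [refineTransition, hs t ht, hs t' ht']
  · intro g' hg'
    obtain ⟨ℓ, τ, h, g, hg, hs, rfl⟩ := hG g' hg'
    simp only [Finset.forall_mem_image]
    intro t ht t' ht'
    simp [refineTransition, P.guard_eq g hg t ht t' ht']
  · intro g' hg'
    obtain ⟨ℓ, τ, h, g, hg, hs, rfl⟩ := hG g' hg'
    rw [Finset.sum_image (refineTransition_injective τ).injOn]
    exact P.sum_prob g hg
  · intro g₁ hg₁ g₂ hg₂ hne
    obtain ⟨ℓ, τ, -, g, hg, -, rfl⟩ := hG g₁ hg₁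
    obtain ⟨ℓ', τ', -, g', hg', -, rfl⟩ := hG g₂ hg₂
    rw [Finset.disjoint_left]
    simp only [Finset.mem_image, not_exists, not_and]
    rintro _ ⟨t, ht, rfl⟩ t' ht' he
    -- The source of a copy records its label, so a common transition forces equal labels and then a
    -- common original.
    obtain rfl : τ' = τ := congrArg (fun t : Transition PV (Loc × Label PV) => t.src.2) he
    obtain rfl := refineTransition_injective _ he
    refine Finset.disjoint_left.1 (P.disjoint g hg g' hg' ?_) ht ht'
    rintro rfl
    exact hne rfl
  · simpa only [Set.Finite.coe_toFinset] using isLeast_refinement P α S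

theorem IsRefinement.gts_eq {P' : PIP PV (Loc × Label PV)} (h : P.IsRefinement α S P') :
    (P'.gts : Set _) = refinedGts P α S :=
  congrArg Prod.snd (h.least.unique (isLeast_refinement P α S))

end Refinement

end PIP

/-! ### Labels as invariants and equality of the optimal values -/

variable {V : Type u} {PV : Finset V} {Loc : Type v}

theorem Rel.sat_toConstraint_congr {r : Rel} {σ σ' : State V} {p q p' q' : MvPolynomial V ℤ}
    (hp : MvPolynomial.eval σ p = MvPolynomial.eval σ' p')
    (hq : MvPolynomial.eval σ q = MvPolynomial.eval σ' q') :
    Sat σ (r.toConstraint p q) ↔ Sat σ' (r.toConstraint p' q') := by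
  cases r <;> simp [Rel.toConstraint, Sat, Atom.Sat, hp, hq]

theorem eval_bind_update (η : Update PV) (σ : State V) (p : MvPolynomial PV ℤ) :
    MvPolynomial.eval σ (MvPolynomial.bind₁ η p) =
      MvPolynomial.eval (fun v => MvPolynomial.eval σ (η v)) p := by
  simp only [← MvPolynomial.coe_aeval_eq_eval]
  exact MvPolynomial.aeval_bind₁ _ _ _

/-- Only the values of the substituted program variables matter. This serves both to change
temporary variables and to pass from `η(ψ)` before a step to `ψ` after it. -/
theorem LayerAtom.sat_subst_congr {ψ : LayerAtom PV} {η η' : Update PV} {σ σ' : State V}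
    (h : ∀ v, MvPolynomial.eval σ (η v) = MvPolynomial.eval σ' (η' v)) :
    Sat σ (ψ.subst η) ↔ Sat σ' (ψ.subst η') := by
  apply Rel.sat_toConstraint_congr <;> rw [eval_bind_update, eval_bind_update] <;>
    simp only [h]

/-- `σ ⊨ τ`. -/
def Label.Holds (σ : State V) (τ : Label PV) : Prop := ∀ ψ ∈ τ, Sat σ ψ.toConstraint

theorem Label.sat_and {τ : Label PV} {φ : Constraint V} {σ : State V} :
    Sat σ (τ.and φ) ↔ Label.Holds σ τ ∧ Sat σ φ := by
  simp only [Label.and, Sat, Label.Holds, List.mem_append, List.mem_flatMap, Finset.mem_toList]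
  constructor
  · exact fun h => ⟨fun ψ hψ a ha => h a (.inl ⟨ψ, hψ, ha⟩), fun a ha => h a (.inr ha)⟩
  · rintro ⟨h1, h2⟩ a (⟨ψ, hψ, ha⟩ | ha)
    · exact h1 ψ hψ a ha
    · exact h2 a ha

theorem Label.Holds.congr {τ : Label PV} {σ σ' : State V} (h : Label.Holds σ τ)
    (hσ : ∀ x ∈ PV, σ' x = σ x) : Label.Holds σ' τ := fun ψ hψ =>
  (LayerAtom.sat_subst_congr fun v => by simp [hσ v v.2]).1 (h ψ hψ)

namespace PIP

theorem holds_nextLabel {α : Loc → Finset (LayerAtom PV)} {τ : Label PV} {t : Transition PV Loc}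
    {σ : State V} (hτ : Label.Holds σ τ) (hφ : Sat σ t.guard) :
    Label.Holds (t.apply σ) (nextLabel α τ t) := by
  intro ψ hψ
  refine (LayerAtom.sat_subst_congr fun v => ?_).1
    ((Finset.mem_filter.1 hψ).2 σ (Label.sat_and.2 ⟨hτ, hφ⟩))
  simp [Transition.apply]

variable {P : PIP PV Loc} {α : Loc → Finset (LayerAtom PV)} {S : Set (Transition PV Loc)}
  {P' : PIP PV (Loc × Label PV)}

theorem IsRefinement.enabled_image (h : P.IsRefinement α S P') {ℓ : Loc} {τ : Label PV}
    {σ σ' : State V} (hl : Labelled P α S ℓ τ) (hτ : Label.Holds σ τ)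
    {g : Finset (Transition PV Loc)} (hg : P.Enabled ⟨some ℓ, σ⟩ g σ') :
    P'.Enabled ⟨some (ℓ, τ), σ⟩ (g.image (refineTransition α S τ)) σ' := by
  obtain ⟨hmem, hσ, hsrc, hsat⟩ := hg
  have hs : ∀ t ∈ g, t.src = ℓ := fun t ht => (Option.some_injective _ (hsrc t ht)).symm
  refine ⟨?_, hσ, ?_, ?_⟩
  · rw [← Finset.mem_coe, h.gts_eq]
    exact ⟨ℓ, τ, hl, g, hmem, hs, rfl⟩
  · simp only [Finset.forall_mem_image]
    intro t ht
    simp [refineTransition, hs t ht]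
  · simp only [Finset.forall_mem_image]
    exact fun t ht => Label.sat_and.2 ⟨hτ.congr hσ, hsat t ht⟩

/-- Refined guards only strengthen the original ones, so the label need not hold here. -/
theorem IsRefinement.exists_enabled (h : P.IsRefinement α S P') {ℓ : Loc} {τ : Label PV}
    {σ σ' : State V} {g' : Finset (Transition PV (Loc × Label PV))}
    (hg : P'.Enabled ⟨some (ℓ, τ), σ⟩ g' σ') :
    ∃ g, P.Enabled ⟨some ℓ, σ⟩ g σ' ∧ g' = g.image (refineTransition α S τ) := by
  obtain ⟨hmem, hσ, hsrc, hsat⟩ := hg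
  rw [← Finset.mem_coe, h.gts_eq] at hmem
  obtain ⟨ℓ', τ', -, g, hg, hs, rfl⟩ := hmem
  simp only [Finset.forall_mem_image] at hsrc hsat
  obtain ⟨t, ht⟩ := nonempty_of_mem_gts hg
  obtain rfl : τ = τ' := congrArg Prod.snd (Option.some_injective _ (hsrc ht))
  refine ⟨g, ⟨hg, hσ, fun t ht => ?_, fun t ht => (Label.sat_and.1 (hsat ht)).2⟩, rfl⟩
  exact congrArg some (congrArg Prod.fst (Option.some_injective _ (hsrc ht)))

/-- Refinement preserves the finite-horizon values where the labels hold. -/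
theorem IsRefinement.optValue_eq (h : P.IsRefinement α S P') (n : ℕ)
    {ℓ : Loc} {τ : Label PV} {σ : State V} (hl : Labelled P α S ℓ τ) (hτ : Label.Holds σ τ) :
    P'.optValue 1 n ⟨some (ℓ, τ), σ⟩ = P.optValue 1 n ⟨some ℓ, σ⟩ := by
  induction n generalizing ℓ τ σ with
  | zero => rfl
  | succ n ih =>
    -- Matching choices have equal continuation values, because each target carries a label that
    -- holds after the step.
    have key : ∀ g σ', P.Enabled ⟨some ℓ, σ⟩ g σ' →
        expectedNext (g.image (refineTransition α S τ)) σ' (P'.optValue 1 n) =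
          expectedNext g σ' (P.optValue 1 n) := by
      rintro g σ' ⟨hg, hσ, hsrc, hsat⟩
      rw [expectedNext, Finset.sum_image (refineTransition_injective τ).injOn]
      refine Finset.sum_congr rfl fun t ht => congrArg _ ?_
      have hs : ℓ = t.src := Option.some_injective _ (hsrc t ht)
      refine ih (labelled_tgt hg ht (hs ▸ hl)) ?_
      split_ifs
      · exact holds_nextLabel (hτ.congr hσ) (hsat t ht)
      · exact fun ψ hψ => absurd hψ (Finset.notMem_empty ψ)
    refine le_antisymm (iSup_le fun g' => iSup_le fun σ' => iSup_le fun hg' => ?_)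
      (iSup_le fun g => iSup_le fun σ' => iSup_le fun hg => ?_)
    · obtain ⟨g, hg, rfl⟩ := h.exists_enabled hg'
      rw [key g σ' hg]
      exact le_optValue_succ hg 1 n
    · rw [← key g σ' hg]
      exact le_optValue_succ (h.enabled_image hl hτ hg) 1 n

theorem IsRefinement.iSup_expectedRuntime_eq (h : P.IsRefinement α S P') (σ₀ : State V) :
    (⨆ 𝔖 : P.Scheduler, 𝔖.expectedRuntime σ₀) =
      ⨆ 𝔖' : P'.Scheduler, 𝔖'.expectedRuntime σ₀ := by
  rw [PIP.iSup_expectedRuntime_eq, PIP.iSup_expectedRuntime_eq, h.init_eq]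
  exact iSup_congr fun n => (h.optValue_eq n (.initial P.init_mem)
    fun ψ hψ => absurd hψ (Finset.notMem_empty ψ)).symm

end PIP

end CFR

end

theorem theorem1 {V : Type*} {PV : Finset V} {Loc : Type*} (P : CFR.PIP PV Loc)
    (α : Loc → Finset (CFR.LayerAtom PV)) (S : Set (CFR.Transition PV Loc))
    (hS : S ⊆ P.transitions) :
    (∃ P' : CFR.PIP PV (Loc × CFR.Label PV), P.IsRefinement α S P') ∧
    ∀ P' : CFR.PIP PV (Loc × CFR.Label PV), P.IsRefinement α S P' →
      ∀ σ₀ : CFR.State V,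
        (⨆ 𝔖 : P.Scheduler, 𝔖.expectedRuntime σ₀) =
          ⨆ 𝔖' : P'.Scheduler, 𝔖'.expectedRuntime σ₀ := by
  exact ⟨CFR.PIP.exists_isRefinement hS, fun _ h => h.iSup_expectedRuntime_eq⟩
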